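/- Let $d\ge 1$. Let $\mathcal G(\mathbb R^d)=\mathcal E_M(\mathbb R^d)/\mathcal N(\mathbb R^d)$ be the special Colombeau algebra. Here $\mathcal E_M(\mathbb R^d)$ is the algebra of nets $(u_\varepsilon)_{\varepsilon\in(0,1]}$ of smooth functions $u_\varepsilon:\mathbb R^d\to\mathbb C$ such that for every compact $K\subset\mathbb R^d$ and every $\beta\in\mathbb N_0^d$ there is $N\ge 0$ with $\sup_{x\in K}|\partial^\beta u_\varepsilon(x)|=O(\varepsilon^{-N})$ as $\varepsilon\to 0$, and $\mathcal N(\mathbb R^d)$ is the ideal of those nets such that for all $K$, all $\beta$ and all $m\ge 0$ one has $\sup_{x\in K}|\partial^\beta u_\varepsilon(x)|=O(\varepsilon^{m})$. Let $\widetilde{\mathbb C}$ be the ring of generalized complex numbers, i.e. nets $(c_\varepsilon)_{\varepsilon\in(0,1]}$ of complex numbers with $|c_\varepsilon|=O(\varepsilon^{-N})$ for some $N$, modulo those with $|c_\varepsilon|=O(\varepsilon^{m})$ for all $m$; it embeds in $\mathcal G(\mathbb R^d)$ as the constants, so that each polynomial in $\widetilde{\mathbb C}[x_1,\dots,x_d]$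 defines an element of $\mathcal G(\mathbb R^d)$. For $\alpha\in\mathbb R$, call $u\in\mathcal G(\mathbb R^d)$ homogeneous of degree $\alpha$ if for every real $\lambda>0$ the identity $u(\lambda x)=\lambda^\alpha u(x)$ holds in $\mathcal G(\mathbb R^d)$. Let $\alpha\in\mathbb R$ and let $u\in\mathcal G(\mathbb R^d)$ with $u\neq 0$. 1. If $u$ is homogeneous of degree $\alpha$, then $\alpha$ is a non-negative integer. 2. $u$ is homogeneous of degree $\alpha$ if and only if $\alpha$ is a non-negative integer and $u$ is (the element of $\mathcal G(\mathbb R^d)$ defined by) a homogeneous polynomial of degree $\alpha$ in $x_1,\dots,x_d$ with coefficients in $\widetilde{\mathbb C}$. -/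

import Mathlib

open scoped ContDiff Topology

noncomputable section

namespace Colombeau

/-- The parameter interval `(0,1]` of the regularisation parameter `ε`. -/
abbrev Eps : Type := Set.Ioc (0 : ℝ) 1

/-- The filter "`ε → 0`" on `(0,1]`. -/
def epsToZero : Filter Eps := Filter.comap (fun ε : Eps => (ε : ℝ)) (𝓝 0)

/-- The space `ℝ^d` with its Euclidean norm. -/
abbrev Space (d : ℕ) : Type := EuclideanSpace ℝ (Fin d)

lemma eps_pow_inv_le (ε : Eps) {N M : ℕ} (h : N ≤ M) :
    ((ε : ℝ) ^ N)⁻¹ ≤ ((ε : ℝ) ^ M)⁻¹ := by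
  have h0 : 0 < (ε : ℝ) := ε.2.1
  exact inv_anti₀ (pow_pos h0 _) (pow_le_pow_of_le_one h0.le ε.2.2 h)

lemma one_le_eps_pow_inv (ε : Eps) (N : ℕ) : 1 ≤ ((ε : ℝ) ^ N)⁻¹ := by
  simpa using eps_pow_inv_le ε (Nat.zero_le N)

/-! ### Generalized complex numbers -/

/-- A net of complex numbers with `|c_ε| = O(ε^{-N})` for some `N`. -/
def ModerateNum (c : Eps → ℂ) : Prop :=
  ∃ N : ℕ, ∃ C : ℝ, ∀ᶠ ε in epsToZero, ‖c ε‖ ≤ C * ((ε : ℝ) ^ N)⁻¹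

/-- A net of complex numbers with `|c_ε| = O(ε^m)` for every `m`. -/
def NegligibleNum (c : Eps → ℂ) : Prop :=
  ∀ m : ℕ, ∃ C : ℝ, ∀ᶠ ε in epsToZero, ‖c ε‖ ≤ C * (ε : ℝ) ^ m

lemma ModerateNum.add {a b : Eps → ℂ} (ha : ModerateNum a) (hb : ModerateNum b) :
    ModerateNum (a + b) := by
  obtain ⟨N, C, hC⟩ := ha
  obtain ⟨M, D, hD⟩ := hb
  refine ⟨N + M, |C| + |D|, ?_⟩
  filter_upwards [hC, hD] with ε h1 h2
  have e1 := eps_pow_inv_le ε (Nat.le_add_right N M)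
  have e2 := eps_pow_inv_le ε (Nat.le_add_left M N)
  have p1 : 0 ≤ ((ε : ℝ) ^ N)⁻¹ := zero_le_one.trans (one_le_eps_pow_inv ε N)
  have p2 : 0 ≤ ((ε : ℝ) ^ M)⁻¹ := zero_le_one.trans (one_le_eps_pow_inv ε M)
  calc ‖(a + b) ε‖ ≤ ‖a ε‖ + ‖b ε‖ := norm_add_le _ _
    _ ≤ C * ((ε : ℝ) ^ N)⁻¹ + D * ((ε : ℝ) ^ M)⁻¹ := add_le_add h1 h2
    _ ≤ |C| * ((ε : ℝ) ^ (N + M))⁻¹ + |D| * ((ε : ℝ) ^ (N + M))⁻¹ := by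
        gcongr
        · exact le_abs_self C
        · exact le_abs_self D
    _ = _ := by ring

lemma ModerateNum.mul {a b : Eps → ℂ} (ha : ModerateNum a) (hb : ModerateNum b) :
    ModerateNum (a * b) := by
  obtain ⟨N, C, hC⟩ := ha
  obtain ⟨M, D, hD⟩ := hb
  refine ⟨N + M, C * D, ?_⟩
  filter_upwards [hC, hD] with ε h1 h2
  calc ‖(a * b) ε‖ = ‖a ε‖ * ‖b ε‖ := norm_mul _ _
    _ ≤ (C * ((ε : ℝ) ^ N)⁻¹) * (D * ((ε : ℝ) ^ M)⁻¹) :=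
        mul_le_mul h1 h2 (norm_nonneg _) ((norm_nonneg _).trans h1)
    _ = _ := by rw [pow_add, mul_inv]; ring

lemma moderateNum_const (z : ℂ) : ModerateNum (fun _ => z) :=
  ⟨0, ‖z‖, Filter.Eventually.of_forall fun ε => by simp⟩

/-- The ring of moderate nets of complex numbers. -/
def moderateNumbers : Subalgebra ℂ (Eps → ℂ) where
  carrier := {c | ModerateNum c}
  mul_mem' := ModerateNum.mul
  add_mem' := ModerateNum.add
  algebraMap_mem' z := moderateNum_const z

/-- The ideal of negligible nets of complex numbers. -/
def negligibleNumbers : Ideal moderateNumbers where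
  carrier := {c | NegligibleNum (c : Eps → ℂ)}
  zero_mem' := fun m => ⟨0, Filter.Eventually.of_forall fun ε => by simp⟩
  add_mem' := by
    intro a b ha hb m
    obtain ⟨C, hC⟩ := ha m
    obtain ⟨D, hD⟩ := hb m
    refine ⟨C + D, ?_⟩
    filter_upwards [hC, hD] with ε h1 h2
    rw [add_mul]
    exact (norm_add_le _ _).trans (add_le_add h1 h2)
  smul_mem' := by
    intro a b hb m
    obtain ⟨N, C, hC⟩ : ModerateNum (a : Eps → ℂ) := a.2
    obtain ⟨D, hD⟩ := hb (N + m)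
    refine ⟨C * D, ?_⟩
    filter_upwards [hC, hD] with ε h1 h2
    have h0 : (ε : ℝ) ^ N ≠ 0 := pow_ne_zero _ ε.2.1.ne'
    calc ‖(a : Eps → ℂ) ε * (b : Eps → ℂ) ε‖ = ‖(a : Eps → ℂ) ε‖ * ‖(b : Eps → ℂ) ε‖ :=
          norm_mul _ _
      _ ≤ (C * ((ε : ℝ) ^ N)⁻¹) * (D * (ε : ℝ) ^ (N + m)) :=
          mul_le_mul h1 h2 (norm_nonneg _) ((norm_nonneg _).trans h1)
      _ = _ := by rw [pow_add]; field_simp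

/-- The ring of generalized complex numbers: moderate nets modulo negligible nets. -/
def GenComplex : Type := moderateNumbers ⧸ negligibleNumbers

instance : CommRing GenComplex :=
  inferInstanceAs (CommRing (moderateNumbers ⧸ negligibleNumbers))

/-- The class of a moderate net of complex numbers. -/
def GenComplex.mk : moderateNumbers →+* GenComplex := Ideal.Quotient.mk negligibleNumbers

/-! ### The special Colombeau algebra on `ℝ^d` -/

/-- A net of smooth functions `ℝ^d → ℂ` is moderate if for every compact `K` and every order `k`
there is an `N` such that the derivatives of order `k` are `O(ε^{-N})` uniformly on `K`.
The norm of the `k`-th Fréchet derivative controls, and is controlled by, the finitely many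
partial derivatives `∂^β` with `|β| = k`. -/
def Moderate {d : ℕ} (u : Eps → Space d → ℂ) : Prop :=
  (∀ ε, ContDiff ℝ ∞ (u ε)) ∧
    ∀ K : Set (Space d), IsCompact K → ∀ k : ℕ, ∃ N : ℕ, ∃ C : ℝ,
      ∀ᶠ ε in epsToZero, ∀ x ∈ K, ‖iteratedFDeriv ℝ k (u ε) x‖ ≤ C * ((ε : ℝ) ^ N)⁻¹

/-- A net of smooth functions `ℝ^d → ℂ` is negligible if for every compact `K`, every order `k`
and every `m` the derivatives of order `k` are `O(ε^m)` uniformly on `K`. -/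
def Negligible {d : ℕ} (u : Eps → Space d → ℂ) : Prop :=
  (∀ ε, ContDiff ℝ ∞ (u ε)) ∧
    ∀ K : Set (Space d), IsCompact K → ∀ k : ℕ, ∀ m : ℕ, ∃ C : ℝ,
      ∀ᶠ ε in epsToZero, ∀ x ∈ K, ‖iteratedFDeriv ℝ k (u ε) x‖ ≤ C * (ε : ℝ) ^ m

section Closure

variable {d : ℕ}

lemma norm_iteratedFDeriv_add_le' {f g : Space d → ℂ} (hf : ContDiff ℝ ∞ f)
    (hg : ContDiff ℝ ∞ g) (k : ℕ) (x : Space d) :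
    ‖iteratedFDeriv ℝ k (f + g) x‖ ≤ ‖iteratedFDeriv ℝ k f x‖ + ‖iteratedFDeriv ℝ k g x‖ := by
  have hk : ((k : ℕ∞) : WithTop ℕ∞) ≤ ∞ := by exact_mod_cast le_top
  rw [iteratedFDeriv_add_apply (hf.of_le hk).contDiffAt (hg.of_le hk).contDiffAt]
  exact norm_add_le _ _

/-- Uniform choice of the exponent and the constant for all orders up to `k`. -/
lemma Moderate.uniform {u : Eps → Space d → ℂ} (hu : Moderate u) {K : Set (Space d)}
    (hK : IsCompact K) (k : ℕ) : ∃ N : ℕ, ∃ C : ℝ, 0 ≤ C ∧ ∀ᶠ ε in epsToZero, ∀ x ∈ K,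
      ∀ j ≤ k, ‖iteratedFDeriv ℝ j (u ε) x‖ ≤ C * ((ε : ℝ) ^ N)⁻¹ := by
  induction k with
  | zero =>
    obtain ⟨N, C, hC⟩ := hu.2 K hK 0
    refine ⟨N, |C|, abs_nonneg _, ?_⟩
    filter_upwards [hC] with ε h x hx j hj
    obtain rfl : j = 0 := by omega
    exact (h x hx).trans (mul_le_mul_of_nonneg_right (le_abs_self C)
      (zero_le_one.trans (one_le_eps_pow_inv ε N)))
  | succ k ih =>
    obtain ⟨M, D, hD0, hD⟩ := ih
    obtain ⟨N, C, hC⟩ := hu.2 K hK (k + 1)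
    refine ⟨M + N, D + |C|, by positivity, ?_⟩
    filter_upwards [hC, hD] with ε h1 h2 x hx j hj
    have e1 := eps_pow_inv_le ε (Nat.le_add_right M N)
    have e2 := eps_pow_inv_le ε (Nat.le_add_left N M)
    have p1 := zero_le_one.trans (one_le_eps_pow_inv ε M)
    have p2 := zero_le_one.trans (one_le_eps_pow_inv ε N)
    have p3 := zero_le_one.trans (one_le_eps_pow_inv ε (M + N))
    rcases Nat.lt_or_ge k j with hkj | hkj
    · obtain rfl : j = k + 1 := by omega
      calc _ ≤ C * ((ε : ℝ) ^ N)⁻¹ := h1 x hx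
        _ ≤ (D + |C|) * ((ε : ℝ) ^ (M + N))⁻¹ :=
          mul_le_mul ((le_abs_self C).trans (by linarith)) e2 p2 (by positivity)
    · calc _ ≤ D * ((ε : ℝ) ^ M)⁻¹ := h2 x hx j hkj
        _ ≤ (D + |C|) * ((ε : ℝ) ^ (M + N))⁻¹ :=
          mul_le_mul (by linarith [abs_nonneg C]) e1 p1 (by positivity)

/-- Uniform choice of the constant for all orders up to `k`. -/
lemma Negligible.uniform {u : Eps → Space d → ℂ} (hu : Negligible u) {K : Set (Space d)}
    (hK : IsCompact K) (k m : ℕ) : ∃ C : ℝ, 0 ≤ C ∧ ∀ᶠ ε in epsToZero, ∀ x ∈ K,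
      ∀ j ≤ k, ‖iteratedFDeriv ℝ j (u ε) x‖ ≤ C * (ε : ℝ) ^ m := by
  induction k with
  | zero =>
    obtain ⟨C, hC⟩ := hu.2 K hK 0 m
    refine ⟨|C|, abs_nonneg _, ?_⟩
    filter_upwards [hC] with ε h x hx j hj
    obtain rfl : j = 0 := by omega
    exact (h x hx).trans (mul_le_mul_of_nonneg_right (le_abs_self C) (pow_nonneg ε.2.1.le _))
  | succ k ih =>
    obtain ⟨D, hD0, hD⟩ := ih
    obtain ⟨C, hC⟩ := hu.2 K hK (k + 1) m
    refine ⟨D + |C|, by positivity, ?_⟩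
    filter_upwards [hC, hD] with ε h1 h2 x hx j hj
    have p : 0 ≤ (ε : ℝ) ^ m := pow_nonneg ε.2.1.le _
    rcases Nat.lt_or_ge k j with hkj | hkj
    · obtain rfl : j = k + 1 := by omega
      exact (h1 x hx).trans (mul_le_mul_of_nonneg_right
        ((le_abs_self C).trans (by linarith)) p)
    · exact (h2 x hx j hkj).trans (mul_le_mul_of_nonneg_right
        (by linarith [abs_nonneg C]) p)

lemma Moderate.add {u v : Eps → Space d → ℂ} (hu : Moderate u) (hv : Moderate v) :
    Moderate (u + v) := by
  refine ⟨fun ε => (hu.1 ε).add (hv.1 ε), fun K hK k => ?_⟩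
  obtain ⟨N, C, hC0, hC⟩ := hu.uniform hK k
  obtain ⟨M, D, hD0, hD⟩ := hv.uniform hK k
  refine ⟨N + M, C + D, ?_⟩
  filter_upwards [hC, hD] with ε h1 h2 x hx
  have e1 := eps_pow_inv_le ε (Nat.le_add_right N M)
  have e2 := eps_pow_inv_le ε (Nat.le_add_left M N)
  calc ‖iteratedFDeriv ℝ k ((u + v) ε) x‖
      ≤ ‖iteratedFDeriv ℝ k (u ε) x‖ + ‖iteratedFDeriv ℝ k (v ε) x‖ :=
        norm_iteratedFDeriv_add_le' (hu.1 ε) (hv.1 ε) k x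
    _ ≤ C * ((ε : ℝ) ^ N)⁻¹ + D * ((ε : ℝ) ^ M)⁻¹ :=
        add_le_add (h1 x hx k le_rfl) (h2 x hx k le_rfl)
    _ ≤ C * ((ε : ℝ) ^ (N + M))⁻¹ + D * ((ε : ℝ) ^ (N + M))⁻¹ := by gcongr
    _ = _ := by ring

/-- Leibniz estimate: bounds on all derivatives up to order `k` multiply. -/
lemma norm_iteratedFDeriv_mul_le' {f g : Space d → ℂ} (hf : ContDiff ℝ ∞ f)
    (hg : ContDiff ℝ ∞ g) (k : ℕ) (x : Space d) {A B : ℝ}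
    (hA : ∀ j ≤ k, ‖iteratedFDeriv ℝ j f x‖ ≤ A) (hB : ∀ j ≤ k, ‖iteratedFDeriv ℝ j g x‖ ≤ B) :
    ‖iteratedFDeriv ℝ k (f * g) x‖ ≤ 2 ^ k * (A * B) := by
  have hk : ((k : ℕ∞) : WithTop ℕ∞) ≤ ∞ := by exact_mod_cast le_top
  have hA0 : 0 ≤ A := (norm_nonneg _).trans (hA 0 (Nat.zero_le k))
  calc ‖iteratedFDeriv ℝ k (f * g) x‖
      ≤ ∑ i ∈ Finset.range (k + 1), (k.choose i : ℝ) * ‖iteratedFDeriv ℝ i f x‖ *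
          ‖iteratedFDeriv ℝ (k - i) g x‖ := norm_iteratedFDeriv_mul_le hf hg x hk
    _ ≤ ∑ i ∈ Finset.range (k + 1), (k.choose i : ℝ) * (A * B) := by
        refine Finset.sum_le_sum fun i hi => ?_
        rw [mul_assoc]
        refine mul_le_mul_of_nonneg_left ?_ (Nat.cast_nonneg _)
        exact mul_le_mul (hA i (by simpa [Nat.lt_succ_iff] using hi)) (hB _ (Nat.sub_le _ _))
          (norm_nonneg _) hA0
    _ = 2 ^ k * (A * B) := by
        rw [← Finset.sum_mul]
        congr 1
        exact_mod_cast Nat.sum_range_choose k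

lemma Moderate.mul {u v : Eps → Space d → ℂ} (hu : Moderate u) (hv : Moderate v) :
    Moderate (u * v) := by
  refine ⟨fun ε => (hu.1 ε).mul (hv.1 ε), fun K hK k => ?_⟩
  obtain ⟨N, C, hC0, hC⟩ := hu.uniform hK k
  obtain ⟨M, D, hD0, hD⟩ := hv.uniform hK k
  refine ⟨N + M, 2 ^ k * (C * D), ?_⟩
  filter_upwards [hC, hD] with ε h1 h2 x hx
  refine (norm_iteratedFDeriv_mul_le' (hu.1 ε) (hv.1 ε) k x (h1 x hx) (h2 x hx)).trans_eq ?_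
  rw [pow_add, mul_inv]; ring

lemma Negligible.add {u v : Eps → Space d → ℂ} (hu : Negligible u) (hv : Negligible v) :
    Negligible (u + v) := by
  refine ⟨fun ε => (hu.1 ε).add (hv.1 ε), fun K hK k m => ?_⟩
  obtain ⟨C, hC⟩ := hu.2 K hK k m
  obtain ⟨D, hD⟩ := hv.2 K hK k m
  refine ⟨C + D, ?_⟩
  filter_upwards [hC, hD] with ε h1 h2 x hx
  rw [add_mul]
  exact (norm_iteratedFDeriv_add_le' (hu.1 ε) (hv.1 ε) k x).trans (add_le_add (h1 x hx) (h2 x hx))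

lemma Moderate.mul_negligible {u v : Eps → Space d → ℂ} (hu : Moderate u) (hv : Negligible v) :
    Negligible (u * v) := by
  refine ⟨fun ε => (hu.1 ε).mul (hv.1 ε), fun K hK k m => ?_⟩
  obtain ⟨N, C, hC0, hC⟩ := hu.uniform hK k
  obtain ⟨D, hD0, hD⟩ := hv.uniform hK k (N + m)
  refine ⟨2 ^ k * (C * D), ?_⟩
  filter_upwards [hC, hD] with ε h1 h2 x hx
  have h0 : (ε : ℝ) ^ N ≠ 0 := pow_ne_zero _ ε.2.1.ne'
  refine (norm_iteratedFDeriv_mul_le' (hu.1 ε) (hv.1 ε) k x (h1 x hx) (h2 x hx)).trans_eq ?_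
  rw [pow_add]; field_simp

/-- The net that is constantly equal to one smooth function is moderate. -/
lemma moderate_of_smooth {f : Space d → ℂ} (hf : ContDiff ℝ ∞ f) : Moderate (fun _ : Eps => f) := by
  refine ⟨fun _ => hf, fun K hK k => ?_⟩
  have hk : ((k : ℕ∞) : WithTop ℕ∞) ≤ ∞ := by exact_mod_cast le_top
  obtain ⟨C, hC⟩ := hK.exists_bound_of_continuousOn (hf.continuous_iteratedFDeriv hk).continuousOn
  exact ⟨0, C, Filter.Eventually.of_forall fun ε x hx => by simpa using hC x hx⟩

end Closure

/-- The ring of moderate nets of smooth functions on `ℝ^d`. -/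
def moderateFunctions (d : ℕ) : Subalgebra ℂ (Eps → Space d → ℂ) where
  carrier := {u | Moderate u}
  mul_mem' := Moderate.mul
  add_mem' := Moderate.add
  algebraMap_mem' z := moderate_of_smooth (f := fun _ => z) contDiff_const

/-- The ideal of negligible nets of smooth functions on `ℝ^d`. -/
def negligibleFunctions (d : ℕ) : Ideal (moderateFunctions d) where
  carrier := {u | Negligible (u : Eps → Space d → ℂ)}
  zero_mem' := ⟨fun _ => contDiff_const (c := (0 : ℂ)), fun K hK k m =>
    ⟨0, Filter.Eventually.of_forall fun ε x hx => by simp⟩⟩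
  add_mem' := Negligible.add
  smul_mem' := fun a _ hb => Moderate.mul_negligible a.2 hb

/-- The special Colombeau algebra on `ℝ^d`. -/
def GenFun (d : ℕ) : Type := moderateFunctions d ⧸ negligibleFunctions d

instance (d : ℕ) : CommRing (GenFun d) :=
  inferInstanceAs (CommRing (moderateFunctions d ⧸ negligibleFunctions d))

instance (d : ℕ) : Algebra ℝ (GenFun d) :=
  inferInstanceAs (Algebra ℝ (moderateFunctions d ⧸ negligibleFunctions d))

/-- The class of a moderate net of smooth functions. -/
def GenFun.mk (d : ℕ) : moderateFunctions d →+* GenFun d :=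
  Ideal.Quotient.mk (negligibleFunctions d)

/-! ### Constants, coordinates, polynomials and scaling -/

section Maps

variable (d : ℕ)

lemma norm_iteratedFDeriv_const_le (z : ℂ) (k : ℕ) (x : Space d) :
    ‖iteratedFDeriv ℝ k (fun _ : Space d => z) x‖ ≤ ‖z‖ := by
  rcases Nat.eq_zero_or_pos k with rfl | hk
  · simp
  · rw [iteratedFDeriv_const_of_ne hk.ne']; simp

/-- A net of numbers as a net of constant functions. -/
def constNet : moderateNumbers →+* moderateFunctions d where
  toFun c := ⟨fun ε _ => (c : Eps → ℂ) ε, fun _ => contDiff_const, fun K hK k => by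
    obtain ⟨N, C, hC⟩ : ModerateNum (c : Eps → ℂ) := c.2
    refine ⟨N, C, ?_⟩
    filter_upwards [hC] with ε h x hx
    exact (norm_iteratedFDeriv_const_le d _ k x).trans h⟩
  map_one' := rfl
  map_mul' _ _ := rfl
  map_zero' := rfl
  map_add' _ _ := rfl

/-- The embedding of the generalized complex numbers into the generalized functions as constants. -/
def constGen : GenComplex →+* GenFun d :=
  Ideal.quotientMap (I := negligibleNumbers) (negligibleFunctions d) (constNet d) (by
    intro c hc
    refine ⟨fun _ => contDiff_const, fun K hK k m => ?_⟩
    obtain ⟨C, hC⟩ := hc m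
    refine ⟨C, ?_⟩
    filter_upwards [hC] with ε h x hx
    exact (norm_iteratedFDeriv_const_le d _ k x).trans h)

/-- The generalized function given by the `i`-th coordinate `x ↦ x_i`. -/
def coordGen (i : Fin d) : GenFun d :=
  GenFun.mk d
    ⟨fun _ x => ((x i : ℝ) : ℂ), moderate_of_smooth
      (Complex.ofRealCLM.contDiff.comp (EuclideanSpace.proj (𝕜 := ℝ) i).contDiff)⟩

/-- The generalized function `x ↦ P(x)` defined by a polynomial in `d` variables with generalized
complex coefficients. -/
def polyGen (P : MvPolynomial (Fin d) GenComplex) : GenFun d :=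
  MvPolynomial.eval₂ (constGen d) (coordGen d) P

variable {d}

lemma norm_iteratedFDeriv_comp_smul (t : ℝ) {f : Space d → ℂ} (hf : ContDiff ℝ ∞ f) (k : ℕ)
    (x : Space d) : ‖iteratedFDeriv ℝ k (fun y => f (t • y)) x‖ =
      |t| ^ k * ‖iteratedFDeriv ℝ k f (t • x)‖ := by
  have hk : ((k : ℕ∞) : WithTop ℕ∞) ≤ ∞ := by exact_mod_cast le_top
  have h := congrFun (iteratedFDeriv_comp_const_smul (i := k) t (hf.of_le hk)) x
  exact (congrArg norm h).trans (by rw [norm_smul, norm_pow, Real.norm_eq_abs])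

/-- The net `(x ↦ u_ε(t x))_ε`. -/
def scaleNet (t : ℝ) : moderateFunctions d →+* moderateFunctions d where
  toFun u := ⟨fun ε x => (u : Eps → Space d → ℂ) ε (t • x),
    fun ε => (u.2.1 ε).comp (contDiff_const_smul t), fun K hK k => by
      obtain ⟨N, C, hC⟩ := u.2.2 _ (hK.image (continuous_const_smul t)) k
      refine ⟨N, |t| ^ k * C, ?_⟩
      filter_upwards [hC] with ε h x hx
      rw [norm_iteratedFDeriv_comp_smul t (u.2.1 ε), mul_assoc]
      exact mul_le_mul_of_nonneg_left (h _ ⟨x, hx, rfl⟩) (by positivity)⟩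
  map_one' := rfl
  map_mul' _ _ := rfl
  map_zero' := rfl
  map_add' _ _ := rfl

/-- The generalized function `x ↦ u(t x)`, for a real number `t`. -/
def scale (t : ℝ) : GenFun d →+* GenFun d :=
  Ideal.quotientMap (I := negligibleFunctions d) (negligibleFunctions d) (scaleNet t) (by
    intro u hu
    refine ⟨fun ε => (hu.1 ε).comp (contDiff_const_smul t), fun K hK k m => ?_⟩
    obtain ⟨C, hC⟩ := hu.2 _ (hK.image (continuous_const_smul t)) k m
    refine ⟨|t| ^ k * C, ?_⟩
    filter_upwards [hC] with ε h x hx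
    refine (norm_iteratedFDeriv_comp_smul t (hu.1 ε) k x).trans_le ?_
    rw [mul_assoc]
    exact mul_le_mul_of_nonneg_left (h _ ⟨x, hx, rfl⟩) (by positivity))

/-- `u` is homogeneous of degree `α`: for every real `t > 0`, `u(t x) = t^α u(x)` holds in the
Colombeau algebra. -/
def IsHomogeneousOfDegree (u : GenFun d) (α : ℝ) : Prop :=
  ∀ t : ℝ, 0 < t → scale t u = (t ^ α : ℝ) • u

end Maps

end Colombeau

end

/-! Homogeneity is used only at the single scale 1/2. Let `w` be a net for which w(x/2) - c w(x) is
negligible, with c > 0. Differentiating j times, 2^{-j} D^j w(x/2) - c D^j w(x) is negligible. This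
has two consequences. If 2^{-j} < c, evaluation where ‖D^j w‖ is maximal on a ball around 0 shows
that D^j w is negligible there (`negligible_iteratedFDeriv_of_half_lt`). If 2^{-j} ≠ c, evaluation
at 0 shows that D^j w(0) is negligible (`negligible_iteratedFDeriv_zero_of_half_ne`). All
sufficiently high derivatives are thus negligible, and the mean value inequality from the origin
carries this down to every lower order, as long as D^j w(0) is negligible also at the critical order
2^{-j} = c (`negligible_of_half`).

For c = 2^{-α} the critical order is j = α. If α is not a natural number there is none, so u = 0. If
α = k, subtract from a representative its Taylor monomial of order k at 0. That monomial is itself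
homogeneous of degree k, so the difference satisfies the same relation, and its k-th derivative at 0
vanishes because iterated derivatives are symmetric (`iteratedFDeriv_diagonal_iteratedFDeriv`).
Hence u equals the monomial, whose coefficients are moderate nets. -/

open scoped ContDiff Topology

noncomputable section

namespace Colombeau

/-! ### Symmetry of higher derivatives, and the top derivative of a Taylor monomial -/

section Symmetry

variable {E F : Type*} [NormedAddCommGroup E] [NormedSpace ℝ E] [NormedAddCommGroup F]
  [NormedSpace ℝ F]

lemma differentiable_iteratedFDeriv_of_smooth {f : E → F} (hf : ContDiff ℝ ∞ f) (n : ℕ) :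
    Differentiable ℝ (iteratedFDeriv ℝ n f) :=
  hf.differentiable_iteratedFDeriv (by exact_mod_cast WithTop.coe_lt_top _)

lemma iteratedFDeriv_succ_apply_eq_fderiv {f : E → F} (hf : ContDiff ℝ ∞ f) (n : ℕ) (x : E)
    (v : Fin (n + 1) → E) : iteratedFDeriv ℝ (n + 1) f x v =
      fderiv ℝ (fun y => iteratedFDeriv ℝ n f y (Fin.tail v)) x (v 0) :=
  (differentiable_iteratedFDeriv_of_smooth hf n x).iteratedFDeriv_succ_apply_left'

/-- The iterated derivative of a smooth function is invariant under adjacent transpositions. -/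
lemma iteratedFDeriv_comp_swap_succ {f : E → F} (hf : ContDiff ℝ ∞ f) (n : ℕ) :
    ∀ (i : Fin n) (x : E) (v : Fin (n + 1) → E),
      iteratedFDeriv ℝ (n + 1) f x (v ∘ Equiv.swap i.castSucc i.succ) =
        iteratedFDeriv ℝ (n + 1) f x v := by
  induction n with
  | zero => exact fun i => i.elim0
  | succ n ih =>
    intro i x v
    induction i using Fin.cases with
    | zero =>
      have h2 : (((2 + n : ℕ) : ℕ∞) : WithTop ℕ∞) ≤ ∞ := WithTop.coe_le_coe.2 le_top
      have hn : ContDiff ℝ 2 (iteratedFDeriv ℝ n f) :=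
        hf.iteratedFDeriv_right (m := 2) h2
      -- Splitting off the two outermost derivatives turns a swap of the first two slots into the
      -- symmetry of the second derivative of `iteratedFDeriv ℝ n f`.
      have key : ∀ w : Fin (n + 2) → E, iteratedFDeriv ℝ (n + 2) f x w =
          fderiv ℝ (fderiv ℝ (iteratedFDeriv ℝ n f)) x (w 0) (w 1) (fun j => w j.succ.succ) := by
        intro w
        have hd : Differentiable ℝ (fderiv ℝ (iteratedFDeriv ℝ n f)) :=
          (hn.fderiv_right (m := 1) (by norm_num)).differentiable (by simp)
        rw [iteratedFDeriv_succ_apply_eq_fderiv hf]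
        have h1 : HasFDerivAt (fun y => fderiv ℝ (iteratedFDeriv ℝ n f) y (w 1))
            ((fderiv ℝ (fderiv ℝ (iteratedFDeriv ℝ n f)) x).flip (w 1)) x := by
          simpa using (hd x).hasFDerivAt.clm_apply (hasFDerivAt_const (w 1) x)
        exact congrArg (fun A => A (w 0))
          (h1.continuousMultilinear_apply_const fun j => w j.succ.succ).fderiv
      have hs : IsSymmSndFDerivAt ℝ (iteratedFDeriv ℝ n f) x :=
        hn.contDiffAt.isSymmSndFDerivAt (by simp)
      rw [key, key, hs.eq]
      have e0 : Equiv.swap (0 : Fin (n + 1)).castSucc (0 : Fin (n + 1)).succ 0 = 1 :=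
        Equiv.swap_apply_left _ _
      have e1 : Equiv.swap (0 : Fin (n + 1)).castSucc (0 : Fin (n + 1)).succ 1 = 0 :=
        Equiv.swap_apply_right _ _
      have e2 : ∀ j : Fin n, Equiv.swap (0 : Fin (n + 1)).castSucc (0 : Fin (n + 1)).succ
          j.succ.succ = j.succ.succ := fun j =>
        Equiv.swap_apply_of_ne_of_ne (by simp [Fin.ext_iff]) (by simp [Fin.ext_iff])
      simp only [Function.comp_apply, e0, e1, e2]
    | succ i =>
      -- This transposition fixes slot 0, so it acts inside the outermost derivative, where the
      -- induction hypothesis holds at every base point.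
      rw [iteratedFDeriv_succ_apply_eq_fderiv hf, iteratedFDeriv_succ_apply_eq_fderiv hf]
      have e0 : (v ∘ Equiv.swap i.succ.castSucc i.succ.succ) 0 = v 0 := by
        simp only [Function.comp_apply]
        rw [Equiv.swap_apply_of_ne_of_ne (by simp [Fin.ext_iff]) (by simp [Fin.ext_iff])]
      have e1 : Fin.tail (v ∘ Equiv.swap i.succ.castSucc i.succ.succ) =
          Fin.tail v ∘ Equiv.swap i.castSucc i.succ := by
        funext j
        simp only [Fin.tail, Function.comp_apply]
        rw [Fin.castSucc_succ,
          (Fin.succ_injective _).swap_apply]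
      rw [e0, e1]
      simp_rw [ih]

/-- The iterated derivative of a smooth function is symmetric. -/
lemma iteratedFDeriv_comp_perm_of_smooth {f : E → F} (hf : ContDiff ℝ ∞ f) {n : ℕ} (x : E)
    (v : Fin n → E) (σ : Equiv.Perm (Fin n)) :
    iteratedFDeriv ℝ n f x (v ∘ σ) = iteratedFDeriv ℝ n f x v := by
  cases n with
  | zero => exact congrArg _ (Subsingleton.elim _ _)
  | succ n =>
    have hσ : σ ∈ Submonoid.closure
        (Set.range fun i : Fin n => Equiv.swap i.castSucc i.succ) := by
      rw [Equiv.Perm.mclosure_swap_castSucc_succ]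
      trivial
    induction hσ using Submonoid.closure_induction generalizing v with
    | mem τ hτ =>
      obtain ⟨i, rfl⟩ := hτ
      exact iteratedFDeriv_comp_swap_succ hf n i x v
    | one => rfl
    | mul a b _ _ ha hb => exact (hb (v ∘ a)).trans (ha v)

/-- The `n`-th derivative at `0` of the `n`-th Taylor monomial of `f` is that of `f`. -/
lemma iteratedFDeriv_diagonal_iteratedFDeriv {f : E → F} (hf : ContDiff ℝ ∞ f) (n : ℕ) :
    iteratedFDeriv ℝ n (fun x => ((n.factorial : ℝ)⁻¹ • iteratedFDeriv ℝ n f 0) fun _ => x) 0 =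
      iteratedFDeriv ℝ n f 0 := by
  ext v
  rw [ContinuousMultilinearMap.iteratedFDeriv_comp_diagonal]
  -- Differentiating along the diagonal gives a sum over permutations; by symmetry its n! terms
  -- coincide and cancel the factorial.
  have h : ∀ σ : Equiv.Perm (Fin n),
      ((n.factorial : ℝ)⁻¹ • iteratedFDeriv ℝ n f 0) (fun i => v (σ i)) =
        (n.factorial : ℝ)⁻¹ • iteratedFDeriv ℝ n f 0 v := fun σ =>
    congrArg ((n.factorial : ℝ)⁻¹ • ·) (iteratedFDeriv_comp_perm_of_smooth hf 0 v σ)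
  simp_rw [h]
  rw [Finset.sum_const, Finset.card_univ, Fintype.card_perm, Fintype.card_fin,
    ← Nat.cast_smul_eq_nsmul ℝ,
    smul_smul, mul_inv_cancel₀ (by positivity), one_smul]

end Symmetry

/-! ### Nets satisfying w(x/2) = c w(x) up to a negligible net -/

section Negligible

variable {d : ℕ}

/-- The `j`-th derivatives of `w(x/2) - c w(x)`. -/
lemma iteratedFDeriv_half_sub {f : Space d → ℂ} (hf : ContDiff ℝ ∞ f) (c : ℝ) (j : ℕ)
    (x : Space d) :
    iteratedFDeriv ℝ j (fun y => f ((2⁻¹ : ℝ) • y) - c • f y) x =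
      (2⁻¹ : ℝ) ^ j • iteratedFDeriv ℝ j f ((2⁻¹ : ℝ) • x) - c • iteratedFDeriv ℝ j f x := by
  have hj : ContDiff ℝ j f := hf.of_le (by exact_mod_cast le_top)
  have h1 : ContDiff ℝ j fun y => f ((2⁻¹ : ℝ) • y) := hj.comp (contDiff_const_smul _)
  have h2 : ContDiff ℝ j fun y => c • f y := hj.const_smul c
  rw [fun_iteratedFDeriv_sub_apply h1.contDiffAt h2.contDiffAt,
    iteratedFDeriv_comp_const_smul _ hj, iteratedFDeriv_const_smul_apply' hj.contDiffAt]

/-- A net with `w(x/2) = c w(x)` up to a negligible net has negligible derivatives of all orders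
`j` with `2^{-j} < c`. -/
lemma negligible_iteratedFDeriv_of_half_lt {w : Eps → Space d → ℂ} (hw : ∀ ε, ContDiff ℝ ∞ (w ε))
    {c : ℝ} (h : Negligible fun ε x => w ε ((2⁻¹ : ℝ) • x) - c • w ε x) {j : ℕ}
    (hj : (2⁻¹ : ℝ) ^ j < c) {R : ℝ} (hR : 0 ≤ R) (m : ℕ) :
    ∃ C : ℝ, 0 ≤ C ∧ ∀ᶠ ε in epsToZero, ∀ x ∈ Metric.closedBall (0 : Space d) R,
      ‖iteratedFDeriv ℝ j (w ε) x‖ ≤ C * (ε : ℝ) ^ m := by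
  obtain ⟨C, hC0, hC⟩ := h.uniform (isCompact_closedBall (0 : Space d) R) j m
  have hpos : 0 < c - (2⁻¹ : ℝ) ^ j := sub_pos.2 hj
  refine ⟨C / (c - (2⁻¹ : ℝ) ^ j), by positivity, ?_⟩
  filter_upwards [hC] with ε hε x hx
  have hcont : Continuous (iteratedFDeriv ℝ j (w ε)) :=
    (hw ε).continuous_iteratedFDeriv (by exact_mod_cast le_top)
  -- The ball is stable under halving, so with M the maximum, attained at `y`, one gets c M ≤ 2^{-j}
  -- M + C ε^m. The first term on the right is absorbed on the left, which gives the constant C / (c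
  -- - 2^{-j}).
  obtain ⟨y, hy, hmax⟩ := (isCompact_closedBall (0 : Space d) R).exists_isMaxOn
    ⟨x, hx⟩ hcont.norm.continuousOn
  have hy2 : (2⁻¹ : ℝ) • y ∈ Metric.closedBall (0 : Space d) R := by
    simp only [Metric.mem_closedBall, dist_zero_right, norm_smul] at hy ⊢
    norm_num
    linarith [norm_nonneg y]
  have h1 := hε y hy j le_rfl
  rw [iteratedFDeriv_half_sub (hw ε)] at h1
  have h2 : ‖iteratedFDeriv ℝ j (w ε) ((2⁻¹ : ℝ) • y)‖ ≤ ‖iteratedFDeriv ℝ j (w ε) y‖ := hmax hy2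
  have h3 : ‖iteratedFDeriv ℝ j (w ε) x‖ ≤ ‖iteratedFDeriv ℝ j (w ε) y‖ := hmax hx
  have hp : (0 : ℝ) < 2⁻¹ ^ j := by positivity
  have h4 := norm_sub_norm_le (c • iteratedFDeriv ℝ j (w ε) y)
    ((2⁻¹ : ℝ) ^ j • iteratedFDeriv ℝ j (w ε) ((2⁻¹ : ℝ) • y))
  rw [norm_sub_rev, norm_smul, norm_smul, Real.norm_of_nonneg (hp.trans hj).le,
    Real.norm_of_nonneg hp.le] at h4
  have h5 := mul_le_mul_of_nonneg_left h2 hp.le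
  rw [div_mul_eq_mul_div, le_div_iff₀ hpos]
  have h6 := mul_le_mul_of_nonneg_right h3 hpos.le
  linarith

/-- A net with `w(x/2) = c w(x)` up to a negligible net has negligible derivatives at `0` of all
orders `j` with `2^{-j} ≠ c`. -/
lemma negligible_iteratedFDeriv_zero_of_half_ne {w : Eps → Space d → ℂ}
    (hw : ∀ ε, ContDiff ℝ ∞ (w ε)) {c : ℝ}
    (h : Negligible fun ε x => w ε ((2⁻¹ : ℝ) • x) - c • w ε x) {j : ℕ}
    (hj : (2⁻¹ : ℝ) ^ j ≠ c) (m : ℕ) :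
    ∃ C : ℝ, ∀ᶠ ε in epsToZero, ‖iteratedFDeriv ℝ j (w ε) 0‖ ≤ C * (ε : ℝ) ^ m := by
  obtain ⟨C, hC⟩ := h.2 _ (isCompact_singleton (x := (0 : Space d))) j m
  have hpos : 0 < |(2⁻¹ : ℝ) ^ j - c| := abs_pos.2 (sub_ne_zero.2 hj)
  refine ⟨C / |(2⁻¹ : ℝ) ^ j - c|, ?_⟩
  filter_upwards [hC] with ε hε
  have h1 := hε 0 rfl
  rw [iteratedFDeriv_half_sub (hw ε), smul_zero, ← sub_smul, norm_smul, Real.norm_eq_abs] at h1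
  rw [div_mul_eq_mul_div, le_div_iff₀ hpos, mul_comm]
  exact h1

/-- If the derivatives of order `j + 1` are negligible and those of order `j` are negligible
at `0`, then those of order `j` are negligible. -/
lemma negligible_iteratedFDeriv_of_succ {w : Eps → Space d → ℂ} (hw : ∀ ε, ContDiff ℝ ∞ (w ε))
    {R : ℝ} (hR : 0 ≤ R) {j m : ℕ}
    (h0 : ∃ C : ℝ, ∀ᶠ ε in epsToZero, ‖iteratedFDeriv ℝ j (w ε) 0‖ ≤ C * (ε : ℝ) ^ m)
    (h1 : ∃ C : ℝ, 0 ≤ C ∧ ∀ᶠ ε in epsToZero, ∀ x ∈ Metric.closedBall (0 : Space d) R,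
      ‖iteratedFDeriv ℝ (j + 1) (w ε) x‖ ≤ C * (ε : ℝ) ^ m) :
    ∃ C : ℝ, 0 ≤ C ∧ ∀ᶠ ε in epsToZero, ∀ x ∈ Metric.closedBall (0 : Space d) R,
      ‖iteratedFDeriv ℝ j (w ε) x‖ ≤ C * (ε : ℝ) ^ m := by
  obtain ⟨C, hC⟩ := h0
  obtain ⟨D, hD0, hD⟩ := h1
  refine ⟨|C| + D * R, by positivity, ?_⟩
  filter_upwards [hC, hD] with ε hC hD x hx
  have hp : 0 ≤ (ε : ℝ) ^ m := pow_nonneg ε.2.1.le _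
  -- Mean value inequality between 0 and `x`; it contributes the term `D * R` of the constant.
  have h := (convex_closedBall (0 : Space d) R).norm_image_sub_le_of_norm_fderiv_le (𝕜 := ℝ)
    (fun y _ => (hw ε).differentiable_iteratedFDeriv (m := j)
      (by exact_mod_cast WithTop.coe_lt_top _) y)
    (fun y hy => norm_fderiv_iteratedFDeriv.trans_le (hD y hy))
    (Metric.mem_closedBall_self hR) hx
  have hx' : ‖x - 0‖ ≤ R := by simpa using hx
  calc ‖iteratedFDeriv ℝ j (w ε) x‖
      ≤ ‖iteratedFDeriv ℝ j (w ε) 0‖ + ‖iteratedFDeriv ℝ j (w ε) x - iteratedFDeriv ℝ j (w ε) 0‖ :=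
        norm_le_norm_add_norm_sub' _ _
    _ ≤ |C| * (ε : ℝ) ^ m + D * (ε : ℝ) ^ m * R :=
        add_le_add (hC.trans (mul_le_mul_of_nonneg_right (le_abs_self C) hp))
          (h.trans (mul_le_mul_of_nonneg_left hx' (mul_nonneg hD0 hp)))
    _ = _ := by ring

/-- A net with `w(x/2) = c w(x)`, `c > 0`, up to a negligible net is negligible as soon as the
derivatives at `0` of the order `j` with `2^{-j} = c`, if there is one, are negligible. -/
lemma negligible_of_half {w : Eps → Space d → ℂ} (hw : ∀ ε, ContDiff ℝ ∞ (w ε)) {c : ℝ}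
    (hc : 0 < c) (h : Negligible fun ε x => w ε ((2⁻¹ : ℝ) • x) - c • w ε x)
    (h0 : ∀ j m : ℕ, (2⁻¹ : ℝ) ^ j = c →
      ∃ C : ℝ, ∀ᶠ ε in epsToZero, ‖iteratedFDeriv ℝ j (w ε) 0‖ ≤ C * (ε : ℝ) ^ m) :
    Negligible w := by
  refine ⟨hw, fun K hK j m => ?_⟩
  obtain ⟨R, hR0, hR⟩ : ∃ R : ℝ, 0 ≤ R ∧ K ⊆ Metric.closedBall 0 R := by
    obtain ⟨R, hR⟩ := hK.isBounded.subset_closedBall (0 : Space d)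
    exact ⟨max R 0, le_max_right _ _, hR.trans (Metric.closedBall_subset_closedBall
      (le_max_left _ _))⟩
  -- The descent to order `j` starts at order `j + n`, which is at least `n` and hence in the range
  -- 2^{-i} < c.
  obtain ⟨n, hn⟩ := exists_pow_lt_of_lt_one hc (by norm_num : (2⁻¹ : ℝ) < 1)
  have hz : ∀ i : ℕ, ∃ C : ℝ, ∀ᶠ ε in epsToZero,
      ‖iteratedFDeriv ℝ i (w ε) 0‖ ≤ C * (ε : ℝ) ^ m := by
    intro i
    by_cases hi : (2⁻¹ : ℝ) ^ i = c
    · exact h0 i m hi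
    · exact negligible_iteratedFDeriv_zero_of_half_ne hw h hi m
  have main : ∃ C : ℝ, 0 ≤ C ∧ ∀ᶠ ε in epsToZero, ∀ x ∈ Metric.closedBall (0 : Space d) R,
      ‖iteratedFDeriv ℝ j (w ε) x‖ ≤ C * (ε : ℝ) ^ m := by
    refine Nat.decreasingInduction (motive := fun i _ => ∃ C : ℝ, 0 ≤ C ∧
      ∀ᶠ ε in epsToZero, ∀ x ∈ Metric.closedBall (0 : Space d) R,
        ‖iteratedFDeriv ℝ i (w ε) x‖ ≤ C * (ε : ℝ) ^ m)
      (fun i _ hi => negligible_iteratedFDeriv_of_succ hw hR0 (hz i) hi) ?_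
      (Nat.le_add_right j n)
    refine negligible_iteratedFDeriv_of_half_lt hw h (lt_of_le_of_lt ?_ hn) hR0 m
    exact pow_le_pow_of_le_one (by norm_num) (by norm_num) (Nat.le_add_left n j)
  obtain ⟨C, -, hC⟩ := main
  refine ⟨C, ?_⟩
  filter_upwards [hC] with ε hε x hx using hε x (hR hx)

end Negligible

/-! ### Scaling in the quotient algebra; homogeneity of polynomials -/

section Quotient

variable {d : ℕ}

lemma GenFun.mk_eq_mk_iff (u v : moderateFunctions d) :
    GenFun.mk d u = GenFun.mk d v ↔
      Negligible ((u : Eps → Space d → ℂ) - (v : Eps → Space d → ℂ)) :=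
  Ideal.Quotient.eq

lemma GenFun.mk_surjective : Function.Surjective (GenFun.mk d) :=
  Ideal.Quotient.mk_surjective

/-- Translates homogeneity at one scale into the relation between representatives that
`negligible_of_half` requires. -/
lemma scale_mk_eq_smul_iff (u : moderateFunctions d) (t c : ℝ) :
    scale t (GenFun.mk d u) = c • GenFun.mk d u ↔
      Negligible fun ε x => (u : Eps → Space d → ℂ) ε (t • x) - c • (u : Eps → Space d → ℂ) ε x := by
  exact GenFun.mk_eq_mk_iff (scaleNet t u) (c • u)

lemma constGen_mk (c : moderateNumbers) :
    constGen d (GenComplex.mk c) = GenFun.mk d (constNet d c) := rfl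

lemma scale_constGen (t : ℝ) (c : GenComplex) : scale t (constGen d c) = constGen d c := by
  obtain ⟨c, rfl⟩ := Ideal.Quotient.mk_surjective c
  rfl

lemma scale_coordGen (t : ℝ) (i : Fin d) : scale t (coordGen d i) = t • coordGen d i := by
  refine (GenFun.mk_eq_mk_iff (scaleNet t _) (t • _)).2 ?_
  have h0 : Negligible (0 : Eps → Space d → ℂ) := (negligibleFunctions d).zero_mem
  refine (congrArg Negligible (funext fun ε => funext fun x => ?_)).mpr h0
  change (((t • x) i : ℝ) : ℂ) - t • ((x i : ℝ) : ℂ) = 0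
  simp

/-- The generalized function defined by a homogeneous polynomial is homogeneous. -/
lemma isHomogeneousOfDegree_polyGen {P : MvPolynomial (Fin d) GenComplex} {k : ℕ}
    (hP : P.IsHomogeneous k) : IsHomogeneousOfDegree (polyGen d P) k := by
  intro t _
  rw [Real.rpow_natCast, polyGen, MvPolynomial.eval₂_eq, map_sum, Finset.smul_sum]
  refine Finset.sum_congr rfl fun s hs => ?_
  have hk : ∑ i ∈ s.support, s i = k := by
    have := hP (MvPolynomial.mem_support_iff.1 hs)
    simpa [Finsupp.weight_apply, Finsupp.sum] using this
  simp only [map_mul, map_prod, map_pow, scale_constGen, scale_coordGen, smul_pow]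
  rw [Finset.prod_smul, Finset.prod_pow_eq_pow_sum, hk, mul_smul_comm]

end Quotient

/-! ### The Taylor monomial as a polynomial with generalized coefficients -/

section Polynomial

variable {d : ℕ}

/-- Values of the `k`-th derivatives at `0` of a moderate net form moderate nets of numbers. -/
lemma moderateNum_iteratedFDeriv_zero {u : Eps → Space d → ℂ} (hu : Moderate u) (k : ℕ)
    (c : ℝ) (v : Fin k → Space d) :
    ModerateNum fun ε => (c • iteratedFDeriv ℝ k (u ε) 0) v := by
  obtain ⟨N, C, hC⟩ := hu.2 _ (isCompact_singleton (x := (0 : Space d))) k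
  refine ⟨N, |c| * C * ∏ i, ‖v i‖, ?_⟩
  filter_upwards [hC] with ε hε
  have hp : (0 : ℝ) ≤ ∏ i, ‖v i‖ := Finset.prod_nonneg fun i _ => norm_nonneg _
  calc ‖(c • iteratedFDeriv ℝ k (u ε) 0) v‖
      ≤ ‖c • iteratedFDeriv ℝ k (u ε) 0‖ * ∏ i, ‖v i‖ := ContinuousMultilinearMap.le_opNorm _ _
    _ = |c| * ‖iteratedFDeriv ℝ k (u ε) 0‖ * ∏ i, ‖v i‖ := by rw [norm_smul, Real.norm_eq_abs]
    _ ≤ |c| * (C * ((ε : ℝ) ^ N)⁻¹) * ∏ i, ‖v i‖ :=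
        mul_le_mul_of_nonneg_right (mul_le_mul_of_nonneg_left (hε 0 rfl) (abs_nonneg c)) hp
    _ = _ := by ring

/-- The coefficient of `x_{s 1} ⋯ x_{s k}` in the Taylor monomial of order `k` at `0`. -/
def taylorCoeff (u : moderateFunctions d) (k : ℕ) (s : Fin k → Fin d) : moderateNumbers :=
  ⟨fun ε => ((k.factorial : ℝ)⁻¹ • iteratedFDeriv ℝ k ((u : Eps → Space d → ℂ) ε) 0)
    fun i => EuclideanSpace.single (s i) (1 : ℝ), moderateNum_iteratedFDeriv_zero u.2 k _ _⟩

/-- The Taylor monomial of order `k` at `0`, as a polynomial with generalized coefficients. -/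
def taylorPoly (u : moderateFunctions d) (k : ℕ) : MvPolynomial (Fin d) GenComplex :=
  ∑ s : Fin k → Fin d,
    MvPolynomial.C (GenComplex.mk (taylorCoeff u k s)) * ∏ i, MvPolynomial.X (s i)

lemma isHomogeneous_taylorPoly (u : moderateFunctions d) (k : ℕ) :
    (taylorPoly u k).IsHomogeneous k := by
  refine MvPolynomial.IsHomogeneous.sum _ _ _ fun s _ => MvPolynomial.IsHomogeneous.C_mul ?_ _
  simpa using MvPolynomial.IsHomogeneous.prod Finset.univ
    (fun i => (MvPolynomial.X (s i) : MvPolynomial (Fin d) GenComplex)) (fun _ => 1)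
    (fun i _ => MvPolynomial.isHomogeneous_X _ _)

/-- The net of the coordinate function `x ↦ x_i`. -/
def coordNet (i : Fin d) : moderateFunctions d :=
  ⟨fun _ x => ((x i : ℝ) : ℂ), moderate_of_smooth
    (Complex.ofRealCLM.contDiff.comp (EuclideanSpace.proj (𝕜 := ℝ) i).contDiff)⟩

/-- The net of the Taylor monomials of order `k` at `0`. -/
def taylorNet (u : moderateFunctions d) (k : ℕ) : moderateFunctions d :=
  ∑ s : Fin k → Fin d, constNet d (taylorCoeff u k s) * ∏ i, coordNet (s i)

lemma polyGen_taylorPoly (u : moderateFunctions d) (k : ℕ) :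
    polyGen d (taylorPoly u k) = GenFun.mk d (taylorNet u k) := by
  simp only [polyGen, taylorPoly, taylorNet, MvPolynomial.eval₂_sum, MvPolynomial.eval₂_mul,
    MvPolynomial.eval₂_C, MvPolynomial.eval₂_prod, MvPolynomial.eval₂_X, map_sum, map_mul,
    map_prod, constGen_mk]
  rfl

/-- Multilinear expansion of `x` in the standard basis. Summing over all index maps `s` instead of
multi-indices avoids multinomial coefficients. -/
lemma taylorNet_apply (u : moderateFunctions d) (k : ℕ) (ε : Eps) :
    (taylorNet u k : Eps → Space d → ℂ) ε = fun x =>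
      ((k.factorial : ℝ)⁻¹ • iteratedFDeriv ℝ k ((u : Eps → Space d → ℂ) ε) 0) fun _ => x := by
  funext x
  have hx : (fun _ : Fin k => x) =
      fun _ : Fin k => ∑ i : Fin d, x i • EuclideanSpace.single i (1 : ℝ) := by
    funext _
    ext j
    simp [Finset.sum_apply, Pi.single_apply]
  rw [hx, ContinuousMultilinearMap.map_sum]
  simp only [ContinuousMultilinearMap.map_smul_univ]
  simp only [taylorNet, AddSubmonoidClass.coe_finsetSum, MulMemClass.coe_mul,
    SubmonoidClass.coe_finsetProd, Finset.sum_apply, Pi.mul_apply, Finset.prod_apply]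
  refine Finset.sum_congr rfl fun s _ => ?_
  change (taylorCoeff u k s : Eps → ℂ) ε * ∏ i, ((x (s i) : ℝ) : ℂ) = _
  rw [Complex.real_smul, Complex.ofReal_prod, mul_comm]
  rfl

end Polynomial

/-! ### Identification of homogeneous generalized functions and of their degrees -/

/-- A homogeneous generalized function is given by its Taylor monomial of order `k`, if its
degree is `k`. -/
lemma eq_polyGen_taylorPoly {d : ℕ} {u : moderateFunctions d} {k : ℕ}
    (h : IsHomogeneousOfDegree (GenFun.mk d u) k) :
    GenFun.mk d u = polyGen d (taylorPoly u k) := by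
  -- Both `u` and its Taylor monomial scale by 2^{-k}, hence so does the difference.
  have hq : scale (2⁻¹ : ℝ) (GenFun.mk d (u - taylorNet u k)) =
      ((2⁻¹ : ℝ) ^ (k : ℝ)) • GenFun.mk d (u - taylorNet u k) := by
    rw [map_sub, map_sub, smul_sub, h _ (by norm_num), ← polyGen_taylorPoly,
      isHomogeneousOfDegree_polyGen (isHomogeneous_taylorPoly u k) _ (by norm_num)]
  rw [polyGen_taylorPoly, GenFun.mk_eq_mk_iff]
  rw [scale_mk_eq_smul_iff, Real.rpow_natCast] at hq
  refine negligible_of_half (fun ε => (u - taylorNet u k).2.1 ε) (by positivity) hq ?_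
  intro j m hj
  -- The only critical order is `k`, where the derivative of the difference at 0 is exactly zero;
  -- hence the constant 0 below.
  obtain rfl : j = k := (pow_right_inj₀ (by norm_num) (by norm_num)).1 hj
  refine ⟨0, Filter.Eventually.of_forall fun ε => ?_⟩
  have hle : ((j : ℕ∞) : WithTop ℕ∞) ≤ ∞ := WithTop.coe_le_coe.2 le_top
  rw [zero_mul, norm_le_zero_iff]
  refine (iteratedFDeriv_sub_apply ((u.2.1 ε).of_le hle).contDiffAt
    (((taylorNet u j).2.1 ε).of_le hle).contDiffAt).trans ?_
  rw [taylorNet_apply, iteratedFDeriv_diagonal_iteratedFDeriv (u.2.1 ε), sub_self]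

/-- The degree of a nonzero homogeneous generalized function is a natural number. -/
lemma exists_nat_eq_of_isHomogeneousOfDegree {d : ℕ} {α : ℝ} {u : GenFun d} (hu : u ≠ 0)
    (h : IsHomogeneousOfDegree u α) : ∃ k : ℕ, α = k := by
  by_contra hα
  obtain ⟨u, rfl⟩ := GenFun.mk_surjective u
  refine hu (Ideal.Quotient.eq_zero_iff_mem.2 ?_)
  refine negligible_of_half u.2.1 (Real.rpow_pos_of_pos (by norm_num) α)
    ((scale_mk_eq_smul_iff u 2⁻¹ _).1 (h _ (by norm_num))) fun j m hj => ?_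
  -- A critical order `j` would make `α` equal to `j`, so the condition at the origin is vacuous.
  rw [← Real.rpow_natCast, Real.rpow_right_inj (by norm_num) (by norm_num)] at hj
  exact absurd ⟨j, hj.symm⟩ hα

end Colombeau

end

theorem mainTheorem2 (d : ℕ) (hd : 1 ≤ d) (α : ℝ) (u : Colombeau.GenFun d) (hu : u ≠ 0) :
    (Colombeau.IsHomogeneousOfDegree u α → ∃ k : ℕ, α = (k : ℝ)) ∧
    (Colombeau.IsHomogeneousOfDegree u α ↔
      ∃ k : ℕ, α = (k : ℝ) ∧ ∃ P : MvPolynomial (Fin d) Colombeau.GenComplex,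
        P.IsHomogeneous k ∧ u = Colombeau.polyGen d P) := by
  refine ⟨Colombeau.exists_nat_eq_of_isHomogeneousOfDegree hu, fun h => ?_, ?_⟩
  · obtain ⟨k, rfl⟩ := Colombeau.exists_nat_eq_of_isHomogeneousOfDegree hu h
    obtain ⟨u, rfl⟩ := Colombeau.GenFun.mk_surjective u
    exact ⟨k, rfl, _, Colombeau.isHomogeneous_taylorPoly u k, Colombeau.eq_polyGen_taylorPoly h⟩
  · rintro ⟨k, rfl, P, hP, rfl⟩
    exact Colombeau.isHomogeneousOfDegree_polyGen hP
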